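/- Let $\Bbbk$ be a field, and let $A$ and $Y$ be regular multiplier Hopf algebras over $\Bbbk$ (in the sense of Van Daele) with coproducts $\Delta_A,\Delta_Y$ and counits $\varepsilon_A,\varepsilon_Y$. Write $M(B)$ for the multiplier algebra of a nondegenerate algebra $B$, regard $B$ as a subalgebra of $M(B)$, write $\iota$ for identity maps and $\tau$ for the relevant flips of tensor factors. Let $\rho:Y\to M(A\otimes Y)$ be a linear map such that $T(y\otimes a)=\rho(y)(a\otimes 1)$ and $\overline T(a\otimes y)=(a\otimes 1)\rho(y)$ define linear maps $T:Y\otimes A\to A\otimes Y$ and $\overline T:A\otimes Y\to A\otimes Y$, and let $E\in M(A\otimes Y)$. Assume that $\rho$ and $E$ make $Y$ a symmetric partial $A$-comodule bialgebra, i.e. (1) and (2) hold. (1) (Symmetric partial comodule algebra.) $\rho$ is an injective algebra homomorphism; $E$ is idempotent with $(A\otimes1)E\subseteq A\otimes M(Y)$ and $E(A\otimes 1)\subseteq A\otimes M(Y)$; $\rho(Y)(A\otimes1)\subseteq E(A\otimes Y)$ and $(A\otimes1)\rho(Y)\subseteq (A\otimes Y)E$; and for all $y\in Y$ $$(\iota\otimes\rho)(\rho(y))=(1\otimes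 E)(\Delta_A\otimes\iota)(\rho(y))=(\Delta_A\otimes\iota)(\rho(y))(1\otimes E).$$ (2) (Symmetric partial comodule coalgebra.) For all $y,y'\in Y$, $a\in A$: $(\varepsilon_A\otimes\iota)(\rho(y))=y$; the elements $((\iota\otimes T)(\Delta_Y(y)\otimes a))(1\otimes1\otimes y')$ and $(1\otimes1\otimes y')((\iota\otimes T)(\Delta_Y(y)\otimes a))$ lie in $Y\otimes A\otimes Y$; the element $((\overline T\otimes\iota)(a\otimes\Delta_Y(y)))(1\otimes y'\otimes1)$ lies in $A\otimes Y\otimes Y$; and, as identities of multipliers, $$(\iota\otimes\Delta_Y)T=(T\otimes\iota)(\iota\otimes T)(\Delta_Y\otimes\iota),$$ $$(\iota\otimes T)(T\otimes\iota)(\iota\otimes\Delta_A)=((\iota\otimes\varepsilon_Y)T\otimes\iota\otimes\iota)(\iota\otimes(\Delta_A\otimes\iota)T)(\Delta_Y\otimes\iota),$$ $$(\iota\otimes\overline T)(\iota\otimes\tau)(\overline T\otimes\iota)(\iota\otimes\tau)(\Delta_A\otimes\iota)=((\iota\otimes\varepsilon_Y)\overline T\otimes\iota\otimes\iota)(\iota\otimes\tau_{A\otimes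 Y,Y})((\Delta_A\otimes\iota)\overline T\otimes\iota)(\iota\otimes\Delta_Y).$$ Suppose that $A$ is commutative. Then there is an algebra homomorphism $\widetilde T:M(Y\otimes A)\to M(A\otimes Y)$ with $\widetilde T(x)=T(x)$ for all $x\in Y\otimes A$ and $\widetilde T(1_{M(Y\otimes A)})=E$, and it is unique: every algebra homomorphism $S:M(Y\otimes A)\to M(A\otimes Y)$ that extends $T$ and satisfies $S(1_{M(Y\otimes A)})=E$ equals $\widetilde T$. -/

import Mathlib

open scoped TensorProduct

namespace MultHopf

section Multipliers

variable (k : Type*) [Field k]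

/-- The algebra of pairs `(L, R)` of linear maps on `A` with `a * L b = R a * b`; its product is
`(L, R) (L', R') = (L ∘ L', R' ∘ R)`. -/
def multiplierSubalgebra (A : Type*) [NonUnitalRing A] [Module k A]
    [IsScalarTower k A A] [SMulCommClass k A A] :
    Subalgebra k (Module.End k A × (Module.End k A)ᵐᵒᵖ) where
  carrier := {p | ∀ a b : A, a * p.1 b = p.2.unop a * b}
  mul_mem' {p q} hp hq := by
    intro a b
    simp only [Set.mem_ofPred_eq] at hp hq
    simp [Module.End.mul_apply, hp, hq]
  add_mem' {p q} hp hq := by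
    intro a b
    simp only [Set.mem_ofPred_eq] at hp hq
    simp [mul_add, add_mul, hp, hq]
  algebraMap_mem' r := by
    intro a b
    simp [Module.algebraMap_end_apply, Prod.algebraMap_apply, MulOpposite.algebraMap_apply,
      mul_smul_comm, smul_mul_assoc]

/-- The multiplier algebra `M(A)`. -/
abbrev Multiplier (A : Type*) [NonUnitalRing A] [Module k A]
    [IsScalarTower k A A] [SMulCommClass k A A] : Type _ :=
  ↥(multiplierSubalgebra k A)

variable {k}
variable {A : Type*} [NonUnitalRing A] [Module k A] [IsScalarTower k A A] [SMulCommClass k A A]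
variable {B : Type*} [NonUnitalRing B] [Module k B] [IsScalarTower k B B] [SMulCommClass k B B]

/-- `b ↦ m b`. -/
def Multiplier.left (m : Multiplier k A) : A →ₗ[k] A := m.1.1

/-- `b ↦ b m`. -/
def Multiplier.right (m : Multiplier k A) : A →ₗ[k] A := m.1.2.unop

/-- The multiplier with given left and right action. -/
def Multiplier.mk' (L R : A →ₗ[k] A) (h : ∀ a b : A, a * L b = R a * b) : Multiplier k A :=
  ⟨(L, MulOpposite.op R), h⟩

theorem Multiplier.central (m : Multiplier k A) (a b : A) : a * m.left b = m.right a * b :=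
  m.2 a b

variable (k) in
/-- The canonical homomorphism `A → M(A)`. -/
def incl (A : Type*) [NonUnitalRing A] [Module k A] [IsScalarTower k A A] [SMulCommClass k A A] :
    A →ₙₐ[k] Multiplier k A where
  toFun a := Multiplier.mk' (LinearMap.mulLeft k a) (LinearMap.mulRight k a)
    (fun b c => by simp [mul_assoc])
  map_smul' r a := by
    apply Subtype.ext
    refine Prod.ext ?_ (MulOpposite.unop_injective ?_) <;> ext b <;>
      simp [Multiplier.mk', smul_mul_assoc, mul_smul_comm]
  map_zero' := by
    apply Subtype.ext
    refine Prod.ext ?_ (MulOpposite.unop_injective ?_) <;> ext b <;> simp [Multiplier.mk']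
  map_add' a b := by
    apply Subtype.ext
    refine Prod.ext ?_ (MulOpposite.unop_injective ?_) <;> ext c <;>
      simp [Multiplier.mk', add_mul, mul_add]
  map_mul' a b := by
    apply Subtype.ext
    refine Prod.ext ?_ (MulOpposite.unop_injective ?_) <;> ext c <;>
      simp [Multiplier.mk', mul_assoc]

/-- For `m ∈ M(A)` and `n ∈ M(B)`, the multiplier `m ⊗ n ∈ M(A ⊗ B)`. -/
def Multiplier.tmul (m : Multiplier k A) (n : Multiplier k B) : Multiplier k (A ⊗[k] B) :=
  Multiplier.mk' (TensorProduct.map m.left n.left) (TensorProduct.map m.right n.right) (by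
    intro x y
    induction x with
    | zero => simp
    | add x x' hx hx' => simp only [add_mul, map_add, hx, hx']
    | tmul a b =>
      induction y with
      | zero => simp
      | add y y' hy hy' => simp only [mul_add, map_add, hy, hy']
      | tmul c d => simp [Multiplier.central])

/-- The canonical map `A ⊗ M(B) → M(A ⊗ B)`. -/
def tensorIncl : A ⊗[k] Multiplier k B →ₗ[k] Multiplier k (A ⊗[k] B) :=
  TensorProduct.lift (LinearMap.mk₂ k (fun (a : A) (n : Multiplier k B) => (incl k A a).tmul n)
    (by
      intro a a' n
      apply Subtype.ext
      refine Prod.ext ?_ (MulOpposite.unop_injective ?_) <;>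
        simp [Multiplier.tmul, Multiplier.mk', Multiplier.left, Multiplier.right,
          TensorProduct.map_add_left])
    (by
      intro r a n
      apply Subtype.ext
      refine Prod.ext ?_ (MulOpposite.unop_injective ?_) <;>
        simp [Multiplier.tmul, Multiplier.mk', Multiplier.left, Multiplier.right,
          TensorProduct.map_smul_left])
    (by
      intro a n n'
      apply Subtype.ext
      refine Prod.ext ?_ (MulOpposite.unop_injective ?_) <;>
        simp [Multiplier.tmul, Multiplier.mk', Multiplier.left, Multiplier.right,
          TensorProduct.map_add_right])
    (by
      intro r a n
      apply Subtype.ext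
      refine Prod.ext ?_ (MulOpposite.unop_injective ?_) <;>
        simp [Multiplier.tmul, Multiplier.mk', Multiplier.left, Multiplier.right,
          TensorProduct.map_smul_right]))

variable (A) in
/-- Nondegeneracy of the product of `A`. -/
def Nondegenerate : Prop :=
  (∀ a : A, (∀ b : A, a * b = 0) → a = 0) ∧ (∀ b : A, (∀ a : A, a * b = 0) → b = 0)

end Multipliers

section Nondegeneracy

variable {k : Type*} [Field k]
variable {A : Type*} [NonUnitalRing A] [Module k A] [IsScalarTower k A A] [SMulCommClass k A A]
variable {B : Type*} [NonUnitalRing B] [Module k B] [IsScalarTower k B B] [SMulCommClass k B B]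

theorem eq_zero_of_functionals {V W : Type*} [AddCommGroup V] [Module k V] [AddCommGroup W]
    [Module k W] (x : V ⊗[k] W)
    (h : ∀ g : W →ₗ[k] k, TensorProduct.rid k V (LinearMap.lTensor V g x) = 0) : x = 0 := by
  classical
  let b := Module.Free.chooseBasis k W
  apply (TensorProduct.equivFinsuppOfBasisRight b).injective
  rw [map_zero]
  ext i
  have hi := h (b.coord i)
  rw [Finsupp.zero_apply, ← hi]
  clear hi h
  induction x with
  | zero => simp
  | add x y hx hy => simp only [map_add, Finsupp.add_apply, hx, hy]
  | tmul v w => simp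

theorem eq_zero_of_forall_dual {V : Type*} [AddCommGroup V] [Module k V] (v : V)
    (h : ∀ f : V →ₗ[k] k, f v = 0) : v = 0 :=
  (Module.forall_dual_apply_eq_zero_iff k v).1 h

theorem eq_zero_of_mul_tensor (hA : ∀ a : A, (∀ b : A, a * b = 0) → a = 0)
    (hB : ∀ a : B, (∀ b : B, a * b = 0) → a = 0) (x : A ⊗[k] B)
    (h : ∀ y : A ⊗[k] B, x * y = 0) : x = 0 := by
  apply eq_zero_of_functionals
  intro g
  apply hA
  intro a
  apply eq_zero_of_forall_dual (k := k)
  intro f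
  have key : TensorProduct.lid k B
      (LinearMap.rTensor B (f ∘ₗ LinearMap.mulRight k a) x) = 0 := by
    apply hB
    intro b
    have h1 := congrArg (fun z => TensorProduct.lid k B (LinearMap.rTensor B f z)) (h (a ⊗ₜ b))
    simp only [map_zero] at h1
    rw [← h1]
    clear h1 h
    induction x with
    | zero => simp
    | add x y hx hy => simp only [map_add, add_mul, hx, hy]
    | tmul u v => simp [smul_mul_assoc]
  have h2 := congrArg g key
  rw [map_zero] at h2
  rw [← h2]
  clear h2 key h
  induction x with
  | zero => simp
  | add x y hx hy => simp only [map_add, add_mul, hx, hy]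
  | tmul u v => simp [smul_mul_assoc, mul_comm]

theorem eq_zero_of_tensor_mul (hA : ∀ a : A, (∀ b : A, b * a = 0) → a = 0)
    (hB : ∀ a : B, (∀ b : B, b * a = 0) → a = 0) (x : A ⊗[k] B)
    (h : ∀ y : A ⊗[k] B, y * x = 0) : x = 0 := by
  apply eq_zero_of_functionals
  intro g
  apply hA
  intro a
  apply eq_zero_of_forall_dual (k := k)
  intro f
  have key : TensorProduct.lid k B
      (LinearMap.rTensor B (f ∘ₗ LinearMap.mulLeft k a) x) = 0 := by
    apply hB
    intro b
    have h1 := congrArg (fun z => TensorProduct.lid k B (LinearMap.rTensor B f z)) (h (a ⊗ₜ b))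
    simp only [map_zero] at h1
    rw [← h1]
    clear h1 h
    induction x with
    | zero => simp
    | add x y hx hy => simp only [map_add, mul_add, hx, hy]
    | tmul u v => simp [mul_smul_comm]
  have h2 := congrArg g key
  rw [map_zero] at h2
  rw [← h2]
  clear h2 key h
  induction x with
  | zero => simp
  | add x y hx hy => simp only [map_add, mul_add, hx, hy]
  | tmul u v => simp [mul_smul_comm, mul_comm]

theorem incl_injective_of (hA : ∀ a : A, (∀ b : A, a * b = 0) → a = 0) :
    Function.Injective (incl k A) := by
  intro a a' h
  rw [← sub_eq_zero]
  apply hA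
  intro b
  have := congrArg (fun m => Multiplier.left m b) h
  simp only [incl, Multiplier.left, Multiplier.mk'] at this
  rw [sub_mul, sub_eq_zero]
  exact this

theorem incl_tensor_injective (hA : Nondegenerate A) (hB : Nondegenerate B) :
    Function.Injective (incl k (A ⊗[k] B)) :=
  incl_injective_of (eq_zero_of_mul_tensor hA.1 hB.1)

theorem Nondegenerate.tensor (hA : Nondegenerate A) (hB : Nondegenerate B) :
    Nondegenerate (A ⊗[k] B) :=
  ⟨eq_zero_of_mul_tensor hA.1 hB.1, eq_zero_of_tensor_mul hA.2 hB.2⟩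

theorem Nondegenerate.left_mul (hA : Nondegenerate A) (m : Multiplier k A) (a b : A) :
    m.left (a * b) = m.left a * b := by
  rw [← sub_eq_zero]
  apply hA.2
  intro c
  rw [mul_sub, sub_eq_zero, m.central, ← mul_assoc, ← m.central, mul_assoc]

theorem Nondegenerate.right_mul (hA : Nondegenerate A) (m : Multiplier k A) (a b : A) :
    m.right (a * b) = a * m.right b := by
  rw [← sub_eq_zero]
  apply hA.1
  intro c
  rw [sub_mul, sub_eq_zero, ← m.central, mul_assoc, m.central, mul_assoc]

theorem Multiplier.ext_left_right {m n : Multiplier k A} (h : m.left = n.left)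
    (h' : m.right = n.right) : m = n :=
  Subtype.ext (Prod.ext h (MulOpposite.unop_injective h'))

theorem Multiplier.mul_left (m n : Multiplier k A) : (m * n).left = m.left ∘ₗ n.left := rfl

theorem Multiplier.mul_right (m n : Multiplier k A) : (m * n).right = n.right ∘ₗ m.right := rfl

theorem incl_left_apply (hA : Nondegenerate A) (m : Multiplier k A) (a : A) :
    incl k A (m.left a) = m * incl k A a := by
  apply Multiplier.ext_left_right
  · ext b
    exact (hA.left_mul m a b).symm
  · ext b
    exact m.central b a

theorem incl_right_apply (hA : Nondegenerate A) (m : Multiplier k A) (a : A) :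
    incl k A (m.right a) = incl k A a * m := by
  apply Multiplier.ext_left_right
  · ext b
    exact (m.central a b).symm
  · ext b
    exact (hA.right_mul m b a).symm

end Nondegeneracy

section HopfAlgebras

variable (k : Type*) [Field k]
variable (A : Type*) [NonUnitalRing A] [Module k A] [IsScalarTower k A A] [SMulCommClass k A A]

/-- A multiplier Hopf algebra: a nondegenerate algebra with a homomorphism
`Δ : A → M(A ⊗ A)` such that `Δ(a)(1 ⊗ b)` and `(a ⊗ 1)Δ(b)` lie in `A ⊗ A`, `Δ` is
coassociative, i.e. `(a ⊗ 1 ⊗ 1)(Δ ⊗ ι)(Δ(b)(1 ⊗ c)) = (ι ⊗ Δ)((a ⊗ 1)Δ(b))(1 ⊗ 1 ⊗ c)`,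
and the linear maps `T₁ : a ⊗ b ↦ Δ(a)(1 ⊗ b)` and `T₂ : a ⊗ b ↦ (a ⊗ 1)Δ(b)` are
bijections of `A ⊗ A`. As `A ⊗ A → M(A ⊗ A)` is injective, `Δ` determines `T₁` and `T₂`. -/
structure MultiplierHopfAlgebra where
  nondegenerate : Nondegenerate A
  comul : A →ₙₐ[k] Multiplier k (A ⊗[k] A)
  T₁ : A ⊗[k] A ≃ₗ[k] A ⊗[k] A
  T₁_spec : ∀ a b : A,
    incl k (A ⊗[k] A) (T₁ (a ⊗ₜ b)) = comul a * (1 : Multiplier k A).tmul (incl k A b)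
  T₂ : A ⊗[k] A ≃ₗ[k] A ⊗[k] A
  T₂_spec : ∀ a b : A,
    incl k (A ⊗[k] A) (T₂ (a ⊗ₜ b)) = (incl k A a).tmul (1 : Multiplier k A) * comul b
  coassoc : ∀ a b c : A,
    TensorProduct.assoc k A A A
        (LinearMap.rTensor A T₂.toLinearMap
          ((TensorProduct.assoc k A A A).symm (a ⊗ₜ T₁ (b ⊗ₜ c)))) =
      LinearMap.lTensor A T₁.toLinearMap (TensorProduct.assoc k A A A (T₂ (a ⊗ₜ b) ⊗ₜ c))

/-- A regular multiplier Hopf algebra: the flipped coproduct also makes `A` into a multiplier Hopf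
algebra, i.e. `T₃ : a ⊗ b ↦ Δ(a)(b ⊗ 1)` and `T₄ : a ⊗ b ↦ (1 ⊗ a)Δ(b)` are also bijections of
`A ⊗ A` (the flipped coproduct is automatically coassociative). -/
structure RegularMultiplierHopfAlgebra extends MultiplierHopfAlgebra k A where
  T₃ : A ⊗[k] A ≃ₗ[k] A ⊗[k] A
  T₃_spec : ∀ a b : A,
    incl k (A ⊗[k] A) (T₃ (a ⊗ₜ b)) = comul a * (incl k A b).tmul (1 : Multiplier k A)
  T₄ : A ⊗[k] A ≃ₗ[k] A ⊗[k] A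
  T₄_spec : ∀ a b : A,
    incl k (A ⊗[k] A) (T₄ (a ⊗ₜ b)) = (1 : Multiplier k A).tmul (incl k A a) * comul b

variable {k A}

namespace MultiplierHopfAlgebra

variable (H : MultiplierHopfAlgebra k A)

theorem incl_mulLeft_one_tmul (hA : Nondegenerate A) (a : A) (z : A ⊗[k] A) :
    incl k (A ⊗[k] A) (LinearMap.rTensor A (LinearMap.mulLeft k a) z) =
      (incl k A a).tmul (1 : Multiplier k A) * incl k (A ⊗[k] A) z :=
  incl_left_apply (hA.tensor hA)
    ((incl k A a).tmul (1 : Multiplier k A)) z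

theorem incl_one_tmul_mulRight (hA : Nondegenerate A) (a : A) (z : A ⊗[k] A) :
    incl k (A ⊗[k] A) (LinearMap.lTensor A (LinearMap.mulRight k a) z) =
      incl k (A ⊗[k] A) z * (1 : Multiplier k A).tmul (incl k A a) :=
  incl_right_apply (hA.tensor hA)
    ((1 : Multiplier k A).tmul (incl k A a)) z

theorem T₂_mul_T₁ (a b c d : A) :
    H.T₂ (a ⊗ₜ b) * H.T₁ (c ⊗ₜ d) =
      LinearMap.rTensor A (LinearMap.mulLeft k a) (H.T₁ ((b * c) ⊗ₜ d)) := by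
  apply incl_tensor_injective (k := k) H.nondegenerate H.nondegenerate
  rw [incl_mulLeft_one_tmul H.nondegenerate, map_mul, H.T₁_spec, H.T₂_spec, H.T₁_spec, map_mul]
  simp only [mul_assoc]

theorem mulRight_T₂ (c a b : A) :
    LinearMap.lTensor A (LinearMap.mulRight k b) (H.T₂ (c ⊗ₜ a)) =
      LinearMap.rTensor A (LinearMap.mulLeft k c) (H.T₁ (a ⊗ₜ b)) := by
  apply incl_tensor_injective (k := k) H.nondegenerate H.nondegenerate
  rw [incl_mulLeft_one_tmul H.nondegenerate, incl_one_tmul_mulRight H.nondegenerate, H.T₁_spec, H.T₂_spec, mul_assoc]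

theorem tmul_mul_T₁_symm (w : A ⊗[k] A) (b : A) :
    LinearMap.lTensor A (LinearMap.mul' k A ∘ₗ H.T₁.symm.toLinearMap)
        (TensorProduct.assoc k A A A (w ⊗ₜ b)) =
      LinearMap.mul' k A (H.T₂.symm w) ⊗ₜ b := by
  obtain ⟨w, rfl⟩ := H.T₂.surjective w
  rw [H.T₂.symm_apply_apply]
  induction w with
  | zero => simp
  | add x y hx hy => simp only [map_add, TensorProduct.add_tmul, hx, hy]
  | tmul c a =>
    obtain ⟨v, hv⟩ := H.T₁.surjective (a ⊗ₜ b)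
    have h1 : TensorProduct.assoc k A A A (H.T₂ (c ⊗ₜ a) ⊗ₜ b) =
        TensorProduct.assoc k A A A (LinearMap.rTensor A H.T₂.toLinearMap
          ((TensorProduct.assoc k A A A).symm (c ⊗ₜ H.T₁ v))) := by
      rw [hv]; simp
    have h2 : TensorProduct.assoc k A A A (LinearMap.rTensor A H.T₂.toLinearMap
          ((TensorProduct.assoc k A A A).symm (c ⊗ₜ H.T₁ v))) =
        LinearMap.lTensor A H.T₁.toLinearMap (TensorProduct.assoc k A A A
          (LinearMap.rTensor A H.T₂.toLinearMap
            ((TensorProduct.assoc k A A A).symm (c ⊗ₜ v)))) := by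
      clear h1 hv
      induction v with
      | zero => simp
      | add x y hx hy => simp only [map_add, TensorProduct.tmul_add, hx, hy]
      | tmul p q => rw [H.coassoc]; simp
    have h3 : LinearMap.lTensor A (LinearMap.mul' k A) (TensorProduct.assoc k A A A
          (LinearMap.rTensor A H.T₂.toLinearMap
            ((TensorProduct.assoc k A A A).symm (c ⊗ₜ v)))) =
        LinearMap.rTensor A (LinearMap.mulLeft k c) (H.T₁ v) := by
      clear h1 h2 hv
      induction v with
      | zero => simp
      | add x y hx hy => simp only [map_add, TensorProduct.tmul_add, hx, hy]
      | tmul p q =>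
        rw [← H.mulRight_T₂]
        simp only [TensorProduct.assoc_symm_tmul, LinearMap.rTensor_tmul, LinearEquiv.coe_coe]
        generalize H.T₂ (c ⊗ₜ p) = u
        induction u with
        | zero => simp
        | add x y hx hy => simp only [map_add, TensorProduct.add_tmul, hx, hy]
        | tmul x y => simp
    rw [h1, h2, ← LinearMap.comp_apply, ← LinearMap.lTensor_comp, LinearMap.comp_assoc,
      LinearEquiv.symm_comp, LinearMap.comp_id, h3, hv]
    simp

theorem exists_counit : ∃ ε : A →ₗ[k] k,
    (∀ a b : A, TensorProduct.lid k A (LinearMap.rTensor A ε (H.T₁ (a ⊗ₜ b))) = a * b) ∧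
    (∀ a b : A, TensorProduct.rid k A (LinearMap.lTensor A ε (H.T₂ (a ⊗ₜ b))) = a * b) := by
  rcases subsingleton_or_nontrivial A with hA | hA
  · exact ⟨0, fun a b => Subsingleton.elim _ _, fun a b => Subsingleton.elim _ _⟩
  obtain ⟨x, hx⟩ := exists_ne (0 : A)
  obtain ⟨f, hf⟩ : ∃ f : A →ₗ[k] k, f x = 1 := by
    by_contra! hcon
    refine hx (eq_zero_of_forall_dual (k := k) x fun f => ?_)
    by_contra hfx
    exact hcon ((f x)⁻¹ • f) (by simp [hfx])
  let ε : A →ₗ[k] k :=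
    f ∘ₗ LinearMap.mul' k A ∘ₗ H.T₂.symm.toLinearMap ∘ₗ TensorProduct.mk k A A x
  have h0 : ∀ x' y b : A, x' ⊗ₜ[k] LinearMap.mul' k A (H.T₁.symm (y ⊗ₜ b)) =
      LinearMap.mul' k A (H.T₂.symm (x' ⊗ₜ y)) ⊗ₜ[k] b := by
    intro x' y b
    rw [← H.tmul_mul_T₁_symm]
    simp
  have h1 : ∀ y b : A, LinearMap.mul' k A (H.T₁.symm (y ⊗ₜ b)) = ε y • b := by
    intro y b
    have := congrArg (fun z => TensorProduct.lid k A (LinearMap.rTensor A f z)) (h0 x y b)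
    simpa [hf, ε] using this
  have h2 : ∀ x' y : A, LinearMap.mul' k A (H.T₂.symm (x' ⊗ₜ y)) = ε y • x' := by
    intro x' y
    have := congrArg (fun z => TensorProduct.rid k A (LinearMap.lTensor A f z)) (h0 x' y x)
    rw [h1] at this
    simpa [hf] using this.symm
  have h3 : ∀ z : A ⊗[k] A, TensorProduct.lid k A (LinearMap.rTensor A ε z) =
      LinearMap.mul' k A (H.T₁.symm z) := by
    intro z
    induction z with
    | zero => simp
    | add x y hx hy => simp only [map_add, hx, hy]
    | tmul x y => rw [h1]; simp
  have h4 : ∀ z : A ⊗[k] A, TensorProduct.rid k A (LinearMap.lTensor A ε z) =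
      LinearMap.mul' k A (H.T₂.symm z) := by
    intro z
    induction z with
    | zero => simp
    | add x y hx hy => simp only [map_add, hx, hy]
    | tmul x y => rw [h2]; simp
  exact ⟨ε, fun a b => by rw [h3]; simp, fun a b => by rw [h4]; simp⟩

/-- The counit `ε`: the functional with `(ε ⊗ ι)(Δ(a)(1 ⊗ b)) = ab` and
`(ι ⊗ ε)((a ⊗ 1)Δ(b)) = ab`. -/
noncomputable def counit : A →ₗ[k] k := H.exists_counit.choose

theorem counit_spec :
    (∀ a b : A, TensorProduct.lid k A (LinearMap.rTensor A H.counit (H.T₁ (a ⊗ₜ b))) = a * b) ∧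
    (∀ a b : A, TensorProduct.rid k A (LinearMap.lTensor A H.counit (H.T₂ (a ⊗ₜ b))) = a * b) :=
  H.exists_counit.choose_spec

end MultiplierHopfAlgebra

end HopfAlgebras

noncomputable section Comodules

open TensorProduct LinearMap

variable {k : Type*} [Field k]
variable {A : Type*} [NonUnitalRing A] [Module k A] [IsScalarTower k A A] [SMulCommClass k A A]
variable {Y : Type*} [NonUnitalRing Y] [Module k Y] [IsScalarTower k Y Y] [SMulCommClass k Y Y]

/-- `e ⊗ ι` on `A ⊗ A ⊗ Y`. -/
def onFirstLegs (Y : Type*) [AddCommGroup Y] [Module k Y] (e : A ⊗[k] A ≃ₗ[k] A ⊗[k] A) :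
    A ⊗[k] (A ⊗[k] Y) ≃ₗ[k] A ⊗[k] (A ⊗[k] Y) :=
  (TensorProduct.assoc k A A Y).symm ≪≫ₗ
    TensorProduct.congr e (LinearEquiv.refl k Y) ≪≫ₗ TensorProduct.assoc k A A Y

/-- `d ⊗ c ⊗ v ↦ (Δ(c) ⊗ v)(1 ⊗ d ⊗ 1)`. -/
def MultiplierHopfAlgebra.rightCover (H : MultiplierHopfAlgebra k A) (Y : Type*) [AddCommGroup Y]
    [Module k Y] : A ⊗[k] (A ⊗[k] Y) ≃ₗ[k] A ⊗[k] (A ⊗[k] Y) :=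
  TensorProduct.leftComm k A A Y ≪≫ₗ onFirstLegs Y H.T₁

/-- `a ⊗ b ⊗ v ↦ (a ⊗ 1 ⊗ 1)(Δ(b) ⊗ v)`. -/
def MultiplierHopfAlgebra.leftCover (H : MultiplierHopfAlgebra k A) (Y : Type*) [AddCommGroup Y]
    [Module k Y] : A ⊗[k] (A ⊗[k] Y) ≃ₗ[k] A ⊗[k] (A ⊗[k] Y) :=
  onFirstLegs Y H.T₂

theorem MultiplierHopfAlgebra.leftCover_mul_rightCover (H : MultiplierHopfAlgebra k A)
    (a d : A) (x y : A ⊗[k] Y) :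
    H.leftCover Y (a ⊗ₜ x) * H.rightCover Y (d ⊗ₜ y) =
      TensorProduct.assoc k A A Y (rTensor Y (rTensor A (mulLeft k a) ∘ₗ H.T₁.toLinearMap ∘ₗ
        (TensorProduct.mk k A A).flip d) (x * y)) := by
  induction x with
  | zero => simp
  | add x x' hx hx' => simp only [tmul_add, map_add, add_mul, hx, hx']
  | tmul b u =>
    induction y with
    | zero => simp
    | add y y' hy hy' => simp only [tmul_add, map_add, mul_add, hy, hy']
    | tmul c v =>
      have h : ∀ p q : A ⊗[k] A, TensorProduct.assoc k A A Y (p ⊗ₜ u) *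
          TensorProduct.assoc k A A Y (q ⊗ₜ v) =
            TensorProduct.assoc k A A Y ((p * q) ⊗ₜ (u * v)) := by
        intro p q
        induction p with
        | zero => simp
        | add p p' hp hp' => simp only [add_tmul, map_add, add_mul, hp, hp']
        | tmul p p' =>
          induction q with
          | zero => simp
          | add q q' hq hq' => simp only [add_tmul, map_add, mul_add, hq, hq']
          | tmul q q' => simp
      simp [leftCover, rightCover, onFirstLegs, h, H.T₂_mul_T₁]

/-- The extension `M(A ⊗ Y) → M(A ⊗ A ⊗ Y)` of the homomorphism `Δ ⊗ ι`: the value `D` at `m` is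
given by `D · ((Δ ⊗ ι)(x)(1 ⊗ d ⊗ 1)) = (Δ ⊗ ι)(m x)(1 ⊗ d ⊗ 1)` and
`((a ⊗ 1 ⊗ 1)(Δ ⊗ ι)(x)) · D = (a ⊗ 1 ⊗ 1)(Δ ⊗ ι)(x m)` for `x` in `A ⊗ Y`. -/
def MultiplierHopfAlgebra.comulTensorId (H : MultiplierHopfAlgebra k A)
    (m : Multiplier k (A ⊗[k] Y)) : Multiplier k (A ⊗[k] (A ⊗[k] Y)) :=
  Multiplier.mk'
    ((H.rightCover Y).toLinearMap ∘ₗ lTensor A m.left ∘ₗ (H.rightCover Y).symm.toLinearMap)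
    ((H.leftCover Y).toLinearMap ∘ₗ lTensor A m.right ∘ₗ (H.leftCover Y).symm.toLinearMap) (by
      intro z w
      obtain ⟨z, rfl⟩ := (H.leftCover Y).surjective z
      obtain ⟨w, rfl⟩ := (H.rightCover Y).surjective w
      simp only [LinearMap.comp_apply, LinearEquiv.coe_coe, LinearEquiv.symm_apply_apply]
      induction z with
      | zero => simp
      | add z z' hz hz' => simp only [map_add, add_mul, hz, hz']
      | tmul a x =>
        induction w with
        | zero => simp
        | add w w' hw hw' => simp only [map_add, mul_add, hw, hw']
        | tmul d y =>
          simp only [lTensor_tmul, H.leftCover_mul_rightCover, m.central])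

/-- `m ↦ (x ↦ m x)` as a linear map. -/
def Multiplier.leftHom : Multiplier k A →ₗ[k] A →ₗ[k] A where
  toFun := Multiplier.left
  map_add' _ _ := rfl
  map_smul' _ _ := rfl

/-- `m ↦ (x ↦ x m)` as a linear map. -/
def Multiplier.rightHom : Multiplier k A →ₗ[k] A →ₗ[k] A where
  toFun := Multiplier.right
  map_add' _ _ := rfl
  map_smul' _ _ := rfl

variable (k A Y) in
/-- A linear map `ρ : Y → M(A ⊗ Y)` with `ρ(Y)(A ⊗ 1) ⊆ A ⊗ Y` and `(A ⊗ 1)ρ(Y) ⊆ A ⊗ Y`,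
as every structure below requires, together with the maps `T : y ⊗ a ↦ ρ(y)(a ⊗ 1)` and `Tbar : a ⊗ y ↦ (a ⊗ 1)ρ(y)` into `A ⊗ Y`,
which are determined by `ρ` because `A ⊗ Y → M(A ⊗ Y)` is injective
for nondegenerate `A` and `Y`. -/
structure CoveredMap where
  ρ : Y →ₗ[k] Multiplier k (A ⊗[k] Y)
  T : Y ⊗[k] A →ₗ[k] A ⊗[k] Y
  T_spec : ∀ (y : Y) (a : A),
    incl k (A ⊗[k] Y) (T (y ⊗ₜ a)) = ρ y * (incl k A a).tmul (1 : Multiplier k Y)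
  Tbar : A ⊗[k] Y →ₗ[k] A ⊗[k] Y
  Tbar_spec : ∀ (a : A) (y : Y),
    incl k (A ⊗[k] Y) (Tbar (a ⊗ₜ y)) = (incl k A a).tmul (1 : Multiplier k Y) * ρ y

namespace CoveredMap

variable (C : CoveredMap k A Y)

theorem mulLeft_T (hA : Nondegenerate A) (hY : Nondegenerate Y) (b a : A) (y : Y) :
    rTensor Y (mulLeft k b) (C.T (y ⊗ₜ a)) = rTensor Y (mulRight k a) (C.Tbar (b ⊗ₜ y)) := by
  apply incl_tensor_injective (k := k) hA hY
  have h1 := incl_left_apply (hA.tensor hY (k := k))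
    ((incl k A b).tmul (1 : Multiplier k Y)) (C.T (y ⊗ₜ a))
  have h2 := incl_right_apply (hA.tensor hY (k := k))
    ((incl k A a).tmul (1 : Multiplier k Y)) (C.Tbar (b ⊗ₜ y))
  refine h1.trans (Eq.trans ?_ h2.symm)
  rw [C.T_spec, C.Tbar_spec, mul_assoc]

/-- The multiplier `(ι ⊗ ρ)(ρ(y))` of `A ⊗ A ⊗ Y`, given by
`a ⊗ x ↦ (ι ⊗ ρ)(ρ(y)(a ⊗ 1))(1 ⊗ x)` and `a ⊗ x ↦ (1 ⊗ x)(ι ⊗ ρ)((a ⊗ 1)ρ(y))`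
for `x` in `A ⊗ Y`. -/
def idTensorRho (hA : Nondegenerate A) (hY : Nondegenerate Y) (y : Y) :
    Multiplier k (A ⊗[k] (A ⊗[k] Y)) :=
  Multiplier.mk'
    (lTensor A (TensorProduct.lift (Multiplier.leftHom ∘ₗ C.ρ)) ∘ₗ
      (TensorProduct.assoc k A Y (A ⊗[k] Y)).toLinearMap ∘ₗ
        rTensor (A ⊗[k] Y) (C.T ∘ₗ TensorProduct.mk k Y A y))
    (lTensor A (TensorProduct.lift (Multiplier.rightHom ∘ₗ C.ρ)) ∘ₗ
      (TensorProduct.assoc k A Y (A ⊗[k] Y)).toLinearMap ∘ₗ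
        rTensor (A ⊗[k] Y) (C.Tbar ∘ₗ (TensorProduct.mk k A Y).flip y)) (by
      intro z w
      induction z with
      | zero => simp
      | add z z' hz hz' => simp only [map_add, add_mul, hz, hz']
      | tmul b x =>
        induction w with
        | zero => simp
        | add w w' hw hw' => simp only [map_add, mul_add, hw, hw']
        | tmul a x' =>
          let K : A ⊗[k] Y →ₗ[k] A ⊗[k] (A ⊗[k] Y) :=
            lTensor A (mulLeft k x ∘ₗ (Multiplier.leftHom ∘ₗ C.ρ).flip x')
          have h1 : ∀ t : A ⊗[k] Y, (b ⊗ₜ x) *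
              lTensor A (TensorProduct.lift (Multiplier.leftHom ∘ₗ C.ρ))
                (TensorProduct.assoc k A Y (A ⊗[k] Y) (t ⊗ₜ x')) =
              K (rTensor Y (mulLeft k b) t) := by
            intro t
            induction t with
            | zero => simp
            | add t t' ht ht' => simp only [add_tmul, map_add, mul_add, ht, ht']
            | tmul p v => simp [K]
          have h2 : ∀ t : A ⊗[k] Y,
              lTensor A (TensorProduct.lift (Multiplier.rightHom ∘ₗ C.ρ))
                (TensorProduct.assoc k A Y (A ⊗[k] Y) (t ⊗ₜ x)) * (a ⊗ₜ x') =
              K (rTensor Y (mulRight k a) t) := by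
            intro t
            induction t with
            | zero => simp
            | add t t' ht ht' => simp only [add_tmul, map_add, add_mul, ht, ht']
            | tmul p v =>
              have h5 := congrArg (fun q => (p * a) ⊗ₜ[k] q) ((C.ρ v).central x x').symm
              simp only [K, assoc_tmul, lTensor_tmul, rTensor_tmul, mulRight_apply, lift.tmul,
                Algebra.TensorProduct.tmul_mul_tmul]
              exact h5
          have h3 := h1 (C.T (y ⊗ₜ a))
          have h4 := h2 (C.Tbar (b ⊗ₜ y))
          rw [C.mulLeft_T hA hY] at h3
          simpa using h3.trans h4.symm)

/-- `ρ` and `E` make `Y` a partial `A`-comodule algebra. -/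
structure IsPartialComoduleAlgebra (HA : MultiplierHopfAlgebra k A) (hY : Nondegenerate Y)
    (E : Multiplier k (A ⊗[k] Y)) : Prop where
  injective : Function.Injective C.ρ
  map_mul : ∀ y y' : Y, C.ρ (y * y') = C.ρ y * C.ρ y'
  idem : E * E = E
  mul_E_mem : ∀ a : A, ∃ t : A ⊗[k] Multiplier k Y,
    (incl k A a).tmul (1 : Multiplier k Y) * E = tensorIncl t
  E_mul_mem : ∀ a : A, ∃ t : A ⊗[k] Multiplier k Y,
    E * (incl k A a).tmul (1 : Multiplier k Y) = tensorIncl t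
  T_mem : ∀ (y : Y) (a : A), ∃ x : A ⊗[k] Y, C.T (y ⊗ₜ a) = E.left x
  Tbar_mem : ∀ (a : A) (y : Y), ∃ x : A ⊗[k] Y, C.Tbar (a ⊗ₜ y) = E.right x
  coassoc : ∀ y : Y, C.idTensorRho HA.nondegenerate hY y =
    (1 : Multiplier k A).tmul E * HA.comulTensorId (C.ρ y)

/-- `ρ` and `E` make `Y` a symmetric partial `A`-comodule algebra. -/
structure IsSymmetricPartialComoduleAlgebra (HA : MultiplierHopfAlgebra k A)
    (hY : Nondegenerate Y) (E : Multiplier k (A ⊗[k] Y)) : Prop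
    extends C.IsPartialComoduleAlgebra HA hY E where
  coassoc_symm : ∀ y : Y, C.idTensorRho HA.nondegenerate hY y =
    HA.comulTensorId (C.ρ y) * (1 : Multiplier k A).tmul E

/-- `z = ((ι ⊗ T)(Δ(y) ⊗ a))(1 ⊗ 1 ⊗ y')` in `Y ⊗ A ⊗ Y`. As `Δ(y)` is a multiplier, this is an
equality of multipliers for the first tensor factor: it is required after multiplication
by `u ⊗ 1 ⊗ 1` on either side. -/
def IsCoverRight (HY : RegularMultiplierHopfAlgebra k Y) (y : Y) (a : A) (y' : Y)
    (z : Y ⊗[k] (A ⊗[k] Y)) : Prop :=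
  ∀ u : Y,
    rTensor (A ⊗[k] Y) (mulRight k u) z =
      lTensor Y (lTensor A (mulRight k y')) (lTensor Y C.T
        (TensorProduct.assoc k Y Y A (HY.T₃ (y ⊗ₜ u) ⊗ₜ a))) ∧
    rTensor (A ⊗[k] Y) (mulLeft k u) z =
      lTensor Y (lTensor A (mulRight k y')) (lTensor Y C.T
        (TensorProduct.assoc k Y Y A (HY.T₂ (u ⊗ₜ y) ⊗ₜ a)))

/-- `z = (1 ⊗ 1 ⊗ y')((ι ⊗ T)(Δ(y) ⊗ a))` in `Y ⊗ A ⊗ Y`, in the same sense. -/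
def IsCoverLeft (HY : RegularMultiplierHopfAlgebra k Y) (y : Y) (a : A) (y' : Y)
    (z : Y ⊗[k] (A ⊗[k] Y)) : Prop :=
  ∀ u : Y,
    rTensor (A ⊗[k] Y) (mulRight k u) z =
      lTensor Y (lTensor A (mulLeft k y')) (lTensor Y C.T
        (TensorProduct.assoc k Y Y A (HY.T₃ (y ⊗ₜ u) ⊗ₜ a))) ∧
    rTensor (A ⊗[k] Y) (mulLeft k u) z =
      lTensor Y (lTensor A (mulLeft k y')) (lTensor Y C.T
        (TensorProduct.assoc k Y Y A (HY.T₂ (u ⊗ₜ y) ⊗ₜ a)))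

/-- `z = ((Tbar ⊗ ι)(a ⊗ Δ(y)))(1 ⊗ y' ⊗ 1)` in `A ⊗ Y ⊗ Y`, as multipliers for the third tensor
factor: the equality is required after multiplication by `1 ⊗ 1 ⊗ u` on either side. -/
def IsCoverBar (HY : RegularMultiplierHopfAlgebra k Y) (a : A) (y y' : Y)
    (z : A ⊗[k] (Y ⊗[k] Y)) : Prop :=
  ∀ u : Y,
    lTensor A (lTensor Y (mulRight k u)) z =
      lTensor A (rTensor Y (mulRight k y')) (TensorProduct.assoc k A Y Y (rTensor Y C.Tbar
        ((TensorProduct.assoc k A Y Y).symm (a ⊗ₜ HY.T₁ (y ⊗ₜ u))))) ∧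
    lTensor A (lTensor Y (mulLeft k u)) z =
      lTensor A (rTensor Y (mulRight k y')) (TensorProduct.assoc k A Y Y (rTensor Y C.Tbar
        ((TensorProduct.assoc k A Y Y).symm (a ⊗ₜ HY.T₄ (u ⊗ₜ y)))))

/-- `(ι ⊗ ε)` from `A ⊗ Y` to `A`. -/
def idTensorCounit (A : Type*) [AddCommGroup A] [Module k A]
    (HY : RegularMultiplierHopfAlgebra k Y) : A ⊗[k] Y →ₗ[k] A :=
  (TensorProduct.rid k A).toLinearMap ∘ₗ lTensor A HY.counit

/-- `(ε ⊗ ι)` from `A ⊗ Y` to `Y`. -/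
def counitTensorId (HA : RegularMultiplierHopfAlgebra k A) (Y : Type*) [AddCommGroup Y]
    [Module k Y] : A ⊗[k] Y →ₗ[k] Y :=
  (TensorProduct.lid k Y).toLinearMap ∘ₗ rTensor Y HA.counit

/-- `((ι ⊗ ε)T ⊗ ι ⊗ ι)((ι ⊗ Δ ⊗ ι)(z)(1 ⊗ 1 ⊗ a' ⊗ 1))` for `z` in `Y ⊗ A ⊗ Y`, that is
`x ⊗ b ⊗ w ↦ (ι ⊗ ε)(T(x ⊗ b₁)) ⊗ b₂a' ⊗ w`. -/
def counitT (HA : RegularMultiplierHopfAlgebra k A) (HY : RegularMultiplierHopfAlgebra k Y)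
    (a' : A) : Y ⊗[k] (A ⊗[k] Y) →ₗ[k] A ⊗[k] (A ⊗[k] Y) :=
  rTensor (A ⊗[k] Y) (idTensorCounit A HY ∘ₗ C.T) ∘ₗ
    (TensorProduct.assoc k Y A (A ⊗[k] Y)).symm.toLinearMap ∘ₗ
      lTensor Y ((TensorProduct.assoc k A A Y).toLinearMap ∘ₗ
        rTensor Y (HA.T₁.toLinearMap ∘ₗ (TensorProduct.mk k A A).flip a'))

/-- For `z` in `A ⊗ Y ⊗ Y`, the map
`b ⊗ v ⊗ w ↦ (ι ⊗ ε)(Tbar(b₁ ⊗ w)) ⊗ a'b₂ ⊗ v`. -/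
def counitTbar (HA : RegularMultiplierHopfAlgebra k A) (HY : RegularMultiplierHopfAlgebra k Y)
    (a' : A) : A ⊗[k] (Y ⊗[k] Y) →ₗ[k] A ⊗[k] (A ⊗[k] Y) :=
  rTensor (A ⊗[k] Y) (idTensorCounit A HY ∘ₗ C.Tbar) ∘ₗ
    (TensorProduct.tensorTensorTensorComm k A A Y Y).toLinearMap ∘ₗ
      lTensor (A ⊗[k] A) (TensorProduct.comm k Y Y).toLinearMap ∘ₗ
        rTensor (Y ⊗[k] Y) (HA.T₄.toLinearMap ∘ₗ TensorProduct.mk k A A a')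

/-- `ρ` makes `Y` a partial `A`-comodule coalgebra. The identities are those of multipliers,
covered as follows:
* `counit_left`, `counit_right`: the extension of `ε ⊗ ι` to `M(A ⊗ Y)` sends `ρ(y)` to `y`;
* `comul_right`, `comul_left`: `(ι ⊗ Δ)T(y ⊗ a) = (T ⊗ ι)(ι ⊗ T)(Δ(y) ⊗ a)`,
  multiplied by `1 ⊗ 1 ⊗ y'` on the right, respectively on the left;
* `coassoc`:
  `(ι ⊗ T)(T ⊗ ι)(y ⊗ Δ(a)) = ((ι ⊗ ε)T ⊗ ι ⊗ ι)(ι ⊗ (Δ ⊗ ι)T)(Δ(y) ⊗ a)`,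
  multiplied by `1 ⊗ a' ⊗ y'` on the right. -/
structure IsPartialComoduleCoalgebra (HA : RegularMultiplierHopfAlgebra k A)
    (HY : RegularMultiplierHopfAlgebra k Y) : Prop where
  counit_left : ∀ (y : Y) (x : A ⊗[k] Y),
    counitTensorId HA Y ((C.ρ y).left x) = y * counitTensorId HA Y x
  counit_right : ∀ (y : Y) (x : A ⊗[k] Y),
    counitTensorId HA Y ((C.ρ y).right x) = counitTensorId HA Y x * y
  exists_coverRight : ∀ (y : Y) (a : A) (y' : Y), ∃ z, C.IsCoverRight HY y a y' z
  exists_coverLeft : ∀ (y : Y) (a : A) (y' : Y), ∃ z, C.IsCoverLeft HY y a y' z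
  comul_right : ∀ (y : Y) (a : A) (y' : Y) (z : Y ⊗[k] (A ⊗[k] Y)),
    C.IsCoverRight HY y a y' z →
    lTensor A HY.T₁.toLinearMap (TensorProduct.assoc k A Y Y (C.T (y ⊗ₜ a) ⊗ₜ y')) =
      TensorProduct.assoc k A Y Y (rTensor Y C.T ((TensorProduct.assoc k Y A Y).symm z))
  comul_left : ∀ (y : Y) (a : A) (y' : Y) (z : Y ⊗[k] (A ⊗[k] Y)),
    C.IsCoverLeft HY y a y' z →
    lTensor A (HY.T₄.toLinearMap ∘ₗ (TensorProduct.comm k Y Y).toLinearMap)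
        (TensorProduct.assoc k A Y Y (C.T (y ⊗ₜ a) ⊗ₜ y')) =
      TensorProduct.assoc k A Y Y (rTensor Y C.T ((TensorProduct.assoc k Y A Y).symm z))
  coassoc : ∀ (y : Y) (a a' : A) (y' : Y) (z : Y ⊗[k] (A ⊗[k] Y)),
    C.IsCoverRight HY y a y' z →
    lTensor A (lTensor A (mulRight k y')) (lTensor A C.T (TensorProduct.assoc k A Y A
        (rTensor A C.T ((TensorProduct.assoc k Y A A).symm (y ⊗ₜ HA.T₁ (a ⊗ₜ a')))))) =
      C.counitT HA HY a' z

/-- `ρ` makes `Y` a symmetric partial `A`-comodule coalgebra. The last identity is, with the twists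
that are needed, `(ι ⊗ Tbar)(Tbar ⊗ ι)(Δ(a) ⊗ y) = ((ι ⊗ ε)Tbar ⊗ ι ⊗ ι)((Δ ⊗ ι)Tbar ⊗ ι)(a ⊗ Δ(y))`,
multiplied by `1 ⊗ a' ⊗ 1` on the left and by `1 ⊗ 1 ⊗ y'` on the right. -/
structure IsSymmetricPartialComoduleCoalgebra (HA : RegularMultiplierHopfAlgebra k A)
    (HY : RegularMultiplierHopfAlgebra k Y) : Prop
    extends C.IsPartialComoduleCoalgebra HA HY where
  exists_coverBar : ∀ (a : A) (y y' : Y), ∃ z, C.IsCoverBar HY a y y' z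
  coassoc_symm : ∀ (a a' : A) (y y' : Y) (z : A ⊗[k] (Y ⊗[k] Y)),
    C.IsCoverBar HY a y y' z →
    lTensor A (lTensor A (mulRight k y')) (lTensor A (C.Tbar ∘ₗ
        (TensorProduct.comm k Y A).toLinearMap) (TensorProduct.assoc k A Y A
          (rTensor A C.Tbar ((TensorProduct.assoc k A Y A).symm
            (lTensor A (TensorProduct.comm k A Y).toLinearMap
              (TensorProduct.assoc k A A Y (HA.T₄ (a' ⊗ₜ a) ⊗ₜ y))))))) =
      C.counitTbar HA HY a' z

end CoveredMap

/-- A symmetric partial `A`-comodule bialgebra structure on `Y`: one map `ρ` that makes `Y` both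
a symmetric partial `A`-comodule algebra, with idempotent `E`, and a symmetric partial
`A`-comodule coalgebra. -/
structure SymmetricPartialComoduleBialgebra (HA : RegularMultiplierHopfAlgebra k A)
    (HY : RegularMultiplierHopfAlgebra k Y) extends CoveredMap k A Y where
  E : Multiplier k (A ⊗[k] Y)
  comoduleAlgebra : toCoveredMap.IsSymmetricPartialComoduleAlgebra
    HA.toMultiplierHopfAlgebra HY.nondegenerate E
  comoduleCoalgebra : toCoveredMap.IsSymmetricPartialComoduleCoalgebra HA HY

end Comodules

end MultHopf

/-! A homomorphism `f : B → C` of nondegenerate algebras with `f(B) C = E C` and `C f(B) = C E`, for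
an idempotent `E ∈ M(C)`, extends to multipliers as in the unital case `E = 1`. The image `n` of `m`
has to satisfy `n f(b) = f(m b)` and `n = n E`; these conditions fix `n` on `E C = f(B) C`, hence
everywhere. Existence amounts to `f(b) c ↦ f(m b) c` being well defined, which follows by pairing
with `C f(B)` from the left (`leftAct_rTensor_congr`, `exists_unique_extension`).

It remains to see that `f = T` qualifies. Since `A` is commutative, `M(A) ⊗ 1` is central in `M(A ⊗
Y)` (`Multiplier.tmul_one_comm`), so `T` is multiplicative and `ρ(y)(a ⊗ 1) = (a ⊗ 1)ρ(y)`. The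
comodule algebra axioms say that `E` fixes the image of `T` on both sides.

The substance is `E(A ⊗ Y) ⊆ ρ(Y)(A ⊗ Y)` (`E_left_mem`) and its mirror image (`E_right_mem`).
Evaluate `(ι ⊗ ρ)(ρ(y)) = (1 ⊗ E)(Δ ⊗ ι)(ρ(y))` at `(Δ ⊗ ι)(x)(1 ⊗ d ⊗ 1)` and contract the first
two legs by `p ⊗ q ↦ S(p)q`. As `S(p) ⊗ 1` is central, `E` and each `ρ(v)` pass through the
contraction. The left side therefore stays in `ρ(Y)(A ⊗ Y)`. On the right, `S(c₁)c₂ = ε(c)` leaves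
`E(d ⊗ (ε ⊗ ι)(ρ(y)x))`, which is `E(d ⊗ y y')` with `y' = (ε ⊗ ι)(x)` by the counit axiom. Because
`Y² = Y`, these elements span `E(A ⊗ Y)`. Finally `A² = A` turns `ρ(Y)(A ⊗ Y)` into `T(Y ⊗ A)(A ⊗
Y)`. -/

namespace MultHopf

/-! ### Extending a homomorphism to multiplier algebras, with `1 ↦ E` -/

section Extension

variable {k : Type*} [Field k]
variable {A : Type*} [NonUnitalRing A] [Module k A] [IsScalarTower k A A] [SMulCommClass k A A]
variable {B : Type*} [NonUnitalRing B] [Module k B] [IsScalarTower k B B] [SMulCommClass k B B]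
variable {C : Type*} [NonUnitalRing C] [Module k C] [IsScalarTower k C C] [SMulCommClass k C C]

/-- A multiplier of a nondegenerate algebra is determined by its left action. -/
theorem Nondegenerate.multiplier_ext (hC : Nondegenerate C) {m n : Multiplier k C}
    (h : ∀ c, m.left c = n.left c) : m = n := by
  refine Multiplier.ext_left_right (LinearMap.ext h) (LinearMap.ext fun a => ?_)
  rw [← sub_eq_zero]
  apply hC.1
  intro b
  rw [sub_mul, ← m.central, ← n.central, h, sub_self]

theorem Nondegenerate.right_left_comm (hC : Nondegenerate C) (m n : Multiplier k C) (c : C) :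
    m.right (n.left c) = n.left (m.right c) := by
  rw [← sub_eq_zero]
  apply hC.1
  intro b
  rw [sub_mul, ← m.central, ← hC.left_mul, ← hC.left_mul, ← m.central, sub_self]

/-- The map `b ⊗ c ↦ f(b) c`. -/
noncomputable def leftAct (f : B →ₗ[k] C) : B ⊗[k] C →ₗ[k] C :=
  TensorProduct.lift (LinearMap.mul k C ∘ₗ f)

/-- The map `b ⊗ c ↦ c f(b)`. -/
noncomputable def rightAct (f : B →ₗ[k] C) : B ⊗[k] C →ₗ[k] C :=
  TensorProduct.lift ((LinearMap.mul k C).flip ∘ₗ f)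

@[simp] theorem leftAct_tmul (f : B →ₗ[k] C) (b : B) (c : C) :
    leftAct f (b ⊗ₜ c) = f b * c := rfl

@[simp] theorem rightAct_tmul (f : B →ₗ[k] C) (b : B) (c : C) :
    rightAct f (b ⊗ₜ c) = c * f b := rfl

/-- An algebra homomorphism `f : B → C` and an idempotent `E ∈ M(C)` with `f(B) C = E C` and
`C f(B) = C E`. -/
structure IsNondegenerateOnto (f : B →ₗ[k] C) (E : Multiplier k C) : Prop where
  map_mul : ∀ b b' : B, f (b * b') = f b * f b'
  idem : E * E = E
  left_map : ∀ b, E.left (f b) = f b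
  right_map : ∀ b, E.right (f b) = f b
  left_mem : ∀ c, ∃ t, leftAct f t = E.left c
  right_mem : ∀ c, ∃ t, rightAct f t = E.right c

namespace IsNondegenerateOnto

variable {f : B →ₗ[k] C} {E : Multiplier k C}

theorem left_leftAct (hf : IsNondegenerateOnto f E) (hC : Nondegenerate C) (t : B ⊗[k] C) :
    E.left (leftAct f t) = leftAct f t := by
  induction t with
  | zero => simp
  | add x y hx hy => simp only [map_add, hx, hy]
  | tmul b c => rw [leftAct_tmul, hC.left_mul, hf.left_map]

theorem right_rightAct (hf : IsNondegenerateOnto f E) (hC : Nondegenerate C) (t : B ⊗[k] C) :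
    E.right (rightAct f t) = rightAct f t := by
  induction t with
  | zero => simp
  | add x y hx hy => simp only [map_add, hx, hy]
  | tmul b c => rw [rightAct_tmul, hC.right_mul, hf.right_map]

theorem mul_leftAct (hf : IsNondegenerateOnto f E) (m : Multiplier k B) (b : B) (t : B ⊗[k] C) :
    f b * leftAct f (LinearMap.rTensor C m.left t) = f (m.right b) * leftAct f t := by
  induction t with
  | zero => simp
  | add x y hx hy => simp only [map_add, mul_add, hx, hy]
  | tmul b' c =>
    simp only [LinearMap.rTensor_tmul, leftAct_tmul]
    rw [← mul_assoc, ← mul_assoc, ← hf.map_mul, ← hf.map_mul, m.central]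

/-- The balancing `c f(b) · f(m b') c' = c f(b m) · f(b') c'`: a multiplier of `B` can be shifted
from one side of the pairing to the other. -/
theorem rightAct_mul_leftAct (hf : IsNondegenerateOnto f E) (m : Multiplier k B)
    (s t : B ⊗[k] C) :
    rightAct f s * leftAct f (LinearMap.rTensor C m.left t) =
      rightAct f (LinearMap.rTensor C m.right s) * leftAct f t := by
  induction s with
  | zero => simp
  | add x y hx hy => simp only [map_add, add_mul, hx, hy]
  | tmul b c =>
    simp only [LinearMap.rTensor_tmul, rightAct_tmul, mul_assoc, hf.mul_leftAct]

/-- This is the well-definedness of `f(b) c ↦ f(m b) c`. Both values lie in `E C`, so an element of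
`C` multiplying them from the left may be replaced by one of `C E = C f(B)`; there `m` shifts to the
left factor, and only `leftAct f t` is left of `t`. -/
theorem leftAct_rTensor_congr (hf : IsNondegenerateOnto f E) (hC : Nondegenerate C)
    (m : Multiplier k B) {t t' : B ⊗[k] C} (h : leftAct f t = leftAct f t') :
    leftAct f (LinearMap.rTensor C m.left t) = leftAct f (LinearMap.rTensor C m.left t') := by
  rw [← sub_eq_zero]
  apply hC.2
  intro c
  obtain ⟨s, hs⟩ := hf.right_mem c
  rw [mul_sub, ← hf.left_leftAct hC, ← hf.left_leftAct hC (LinearMap.rTensor C m.left t'),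
    E.central, E.central, ← hs, hf.rightAct_mul_leftAct, hf.rightAct_mul_leftAct, h, sub_self]

/-- The value at `m ∈ M(B)` of the extension of `f`. -/
theorem exists_value (hf : IsNondegenerateOnto f E) (hC : Nondegenerate C)
    (m : Multiplier k B) :
    ∃ n : Multiplier k C, n * E = n ∧ ∀ b, n.left (f b) = f (m.left b) := by
  -- Over a field, `E.left` lifts linearly through `leftAct f`: `s c` writes `E c` as a sum of terms
  -- `f(b) c'`. Likewise `s'` below for `c E`.
  obtain ⟨s, hs⟩ := Module.projective_lifting_property (leftAct f).rangeRestrict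
    (LinearMap.codRestrict (LinearMap.range (leftAct f)) E.left hf.left_mem)
    (LinearMap.surjective_rangeRestrict _)
  obtain ⟨s', hs'⟩ := Module.projective_lifting_property (rightAct f).rangeRestrict
    (LinearMap.codRestrict (LinearMap.range (rightAct f)) E.right hf.right_mem)
    (LinearMap.surjective_rangeRestrict _)
  replace hs : ∀ c, leftAct f (s c) = E.left c := fun c =>
    congrArg Subtype.val (LinearMap.congr_fun hs c)
  replace hs' : ∀ c, rightAct f (s' c) = E.right c := fun c =>
    congrArg Subtype.val (LinearMap.congr_fun hs' c)
  have hE : ∀ c, E.left (E.left c) = E.left c := fun c =>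
    congrArg (fun n => Multiplier.left n c) hf.idem
  let n : Multiplier k C := Multiplier.mk' (leftAct f ∘ₗ LinearMap.rTensor C m.left ∘ₗ s)
    (rightAct f ∘ₗ LinearMap.rTensor C m.right ∘ₗ s') (by
      intro a b
      simp only [LinearMap.comp_apply]
      rw [← hf.left_leftAct hC, E.central, ← hs', hf.rightAct_mul_leftAct, hs, E.central,
        hf.right_rightAct hC])
  have hn : ∀ c, n.left c = leftAct f (LinearMap.rTensor C m.left (s c)) := fun _ => rfl
  refine ⟨n, hC.multiplier_ext fun c => ?_, fun b => ?_⟩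
  · rw [Multiplier.mul_left, LinearMap.comp_apply, hn, hn]
    exact hf.leftAct_rTensor_congr hC m (by rw [hs, hs, hE])
  · rw [← sub_eq_zero]
    apply hC.1
    intro c
    -- `s (f b * c)` and `b ⊗ₜ c` both represent `f(b) c`, so the choice of `s` does not matter.
    rw [sub_mul, ← hC.left_mul, hn, hf.leftAct_rTensor_congr hC m (t' := b ⊗ₜ c)]
    · simp
    · rw [hs, leftAct_tmul, hC.left_mul, hf.left_map]

/-- By `n = n E`, only the action on `E C = f(B) C` matters, and there `n (f(b) c) = (n f(b)) c`. -/
theorem value_unique (hf : IsNondegenerateOnto f E) (hC : Nondegenerate C)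
    {n n' : Multiplier k C} (hn : n * E = n) (hn' : n' * E = n')
    (h : ∀ b, n.left (f b) = n'.left (f b)) : n = n' := by
  refine hC.multiplier_ext fun c => ?_
  rw [← hn, ← hn', Multiplier.mul_left, Multiplier.mul_left, LinearMap.comp_apply,
    LinearMap.comp_apply]
  obtain ⟨t, ht⟩ := hf.left_mem c
  rw [← ht]
  clear ht
  induction t with
  | zero => simp
  | add x y hx hy => simp only [map_add, hx, hy]
  | tmul b c => rw [leftAct_tmul, hC.left_mul, hC.left_mul, h]

/-- A homomorphism `f : B → C` with `f(B) C = E C` and `C f(B) = C E` extends uniquely to a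
homomorphism `M(B) → M(C)` that sends `1` to `E`. -/
theorem exists_unique_extension (hf : IsNondegenerateOnto f E) (hB : Nondegenerate B)
    (hC : Nondegenerate C) :
    ∃ F : Multiplier k B →ₙₐ[k] Multiplier k C,
      (∀ b, F (incl k B b) = incl k C (f b)) ∧ F 1 = E ∧
      ∀ S : Multiplier k B →ₙₐ[k] Multiplier k C,
        (∀ b, S (incl k B b) = incl k C (f b)) → S 1 = E → S = F := by
  choose F hF hFf using hf.exists_value hC
  have left_add : ∀ (n n' : Multiplier k C) (c : C), (n + n').left c = n.left c + n'.left c :=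
    fun _ _ _ => rfl
  refine ⟨{ toFun := F, map_smul' := ?_, map_zero' := ?_, map_add' := ?_, map_mul' := ?_ },
    ?_, ?_, ?_⟩
  · intro r m
    refine hf.value_unique hC (hF _) ?_ fun b => ?_
    · rw [MonoidHom.id_apply, smul_mul_assoc, hF]
    · rw [hFf]
      refine Eq.trans ?_ (congrArg (r • ·) (hFf m b)).symm
      exact map_smul f r (m.left b)
  · refine hf.value_unique hC (hF _) (zero_mul _) fun b => ?_
    rw [hFf]
    exact map_zero f
  · intro m m'
    refine hf.value_unique hC (hF _) (by rw [add_mul, hF, hF]) fun b => ?_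
    rw [left_add, hFf, hFf, hFf]
    exact map_add f _ _
  · intro m m'
    refine hf.value_unique hC (hF _) (by rw [mul_assoc, hF]) fun b => ?_
    rw [hFf, Multiplier.mul_left, Multiplier.mul_left, LinearMap.comp_apply, LinearMap.comp_apply,
      hFf, hFf]
  · intro b
    refine hf.value_unique hC (hF _) ?_ fun b' => ?_
    · rw [← incl_right_apply hC, hf.right_map]
    · exact (hFf _ b').trans (hf.map_mul b b')
  · refine hf.value_unique hC (hF _) hf.idem fun b => ?_
    rw [hf.left_map]
    exact hFf 1 b
  · intro S hS hS1
    refine NonUnitalAlgHom.ext fun m => hf.value_unique hC ?_ (hF m) fun b => ?_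
    -- `S m = S (m * 1) = S m * E`.
    · rw [← hS1]
      exact (NonUnitalAlgHom.map_mul S m 1).symm.trans (by rw [mul_one])
    · refine Eq.trans ?_ (hFf m b).symm
      -- Inside `M(C)`: `S(m) f(b) = S(m) S(b) = S(m b) = f(m b)`.
      apply incl_injective_of (k := k) hC.1
      rw [incl_left_apply hC, ← hS]
      exact (NonUnitalAlgHom.map_mul S m _).symm.trans (by rw [← incl_left_apply hB, hS])

end IsNondegenerateOnto

end Extension

/-! ### Commutative `A`: centrality of `M(A) ⊗ 1` -/

section Commutative

variable {k : Type*} [Field k]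
variable {A : Type*} [NonUnitalRing A] [Module k A] [IsScalarTower k A A] [SMulCommClass k A A]
variable {Y : Type*} [NonUnitalRing Y] [Module k Y] [IsScalarTower k Y Y] [SMulCommClass k Y Y]

theorem Multiplier.tmul_mul_tmul (m m' : Multiplier k A) (n n' : Multiplier k Y) :
    m.tmul n * m'.tmul n' = (m * m').tmul (n * n') :=
  Multiplier.ext_left_right (TensorProduct.ext' fun _ _ => rfl)
    (TensorProduct.ext' fun _ _ => rfl)

theorem Multiplier.left_eq_right (hA : Nondegenerate A) (hcomm : ∀ a b : A, a * b = b * a)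
    (l : Multiplier k A) : l.left = l.right := by
  refine LinearMap.ext fun a => ?_
  rw [← sub_eq_zero]
  apply hA.1
  intro b
  rw [sub_mul, ← l.central, ← hA.left_mul, hcomm a b, hA.left_mul, hcomm, sub_self]

theorem Multiplier.tmul_one_left_eq_right (hA : Nondegenerate A)
    (hcomm : ∀ a b : A, a * b = b * a) (l : Multiplier k A) :
    (l.tmul (1 : Multiplier k Y)).left = (l.tmul (1 : Multiplier k Y)).right :=
  congrArg (fun g => TensorProduct.map g LinearMap.id) (l.left_eq_right hA hcomm)

/-- The left and right actions of `l ⊗ 1` coincide, and the left action of one multiplier commutes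
with the right action of another. Hence the two products have the same right action, and
nondegeneracy gives the same left action. -/
theorem Multiplier.tmul_one_comm (hA : Nondegenerate A) (hY : Nondegenerate Y)
    (hcomm : ∀ a b : A, a * b = b * a) (l : Multiplier k A) (n : Multiplier k (A ⊗[k] Y)) :
    l.tmul (1 : Multiplier k Y) * n = n * l.tmul (1 : Multiplier k Y) := by
  have hAY := hA.tensor (k := k) hY
  have hl := l.tmul_one_left_eq_right (Y := Y) hA hcomm
  have hR : (l.tmul (1 : Multiplier k Y) * n).right = (n * l.tmul (1 : Multiplier k Y)).right := by
    rw [Multiplier.mul_right, Multiplier.mul_right, ← hl]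
    exact LinearMap.ext fun x => hAY.right_left_comm n _ x
  refine Multiplier.ext_left_right (LinearMap.ext fun x => ?_) hR
  rw [← sub_eq_zero]
  apply hAY.2
  intro y
  rw [mul_sub, central, central, hR, sub_self]

/-! ### Counit, antipode, and contraction of the first two legs -/

namespace MultiplierHopfAlgebra

variable (H : MultiplierHopfAlgebra k A)

/-- If `ε = 0`, then `(ε ⊗ ι)(Δ(a)(1 ⊗ b)) = ab` makes every product vanish, against nondegeneracy.
-/
theorem counit_surjective [Nontrivial A] : Function.Surjective H.counit := by
  obtain ⟨a, ha⟩ : ∃ a, H.counit a ≠ 0 := by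
    by_contra! h
    have h0 : H.counit = 0 := LinearMap.ext h
    obtain ⟨x, hx⟩ := exists_ne (0 : A)
    refine hx (H.nondegenerate.1 x fun b => ?_)
    rw [← H.counit_spec.1, h0]
    simp
  exact fun r => ⟨(r / H.counit a) • a, by simp [ha]⟩

/-- The product of a multiplier Hopf algebra is surjective. -/
theorem mul_surjective (H : MultiplierHopfAlgebra k A) : Function.Surjective (LinearMap.mul' k A) := by
  intro a
  rcases subsingleton_or_nontrivial A with hA | hA
  · exact ⟨0, Subsingleton.elim _ _⟩
  obtain ⟨c, hc⟩ := H.counit_surjective 1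
  have h : ∀ w, TensorProduct.lid k A (LinearMap.rTensor A H.counit (H.T₁ w)) =
      LinearMap.mul' k A w := by
    intro w
    induction w with
    | zero => simp
    | add x y hx hy => simp only [map_add, hx, hy]
    | tmul x y => simpa using H.counit_spec.1 x y
  -- Multiplication is `(ε ⊗ ι)T₁`, so it sends `T₁⁻¹(c ⊗ a)` to `ε(c)a = a`.
  refine ⟨H.T₁.symm (c ⊗ₜ a), ?_⟩
  rw [← h]
  simp [hc]

theorem T₁_mulRight (a : A) (z : A ⊗[k] A) :
    H.T₁ (LinearMap.lTensor A (LinearMap.mulRight k a) z) =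
      LinearMap.lTensor A (LinearMap.mulRight k a) (H.T₁ z) := by
  induction z with
  | zero => simp
  | add x y hx hy => simp only [map_add, hx, hy]
  | tmul x y =>
    apply incl_tensor_injective (k := k) H.nondegenerate H.nondegenerate
    rw [incl_one_tmul_mulRight H.nondegenerate, LinearMap.lTensor_tmul, H.T₁_spec, H.T₁_spec,
      LinearMap.mulRight_apply, map_mul, mul_assoc, Multiplier.tmul_mul_tmul, mul_one]

/-- `p ⊗ q ↦ S(p) q`, where `S` is the antipode. -/
noncomputable def antipodeMul : A ⊗[k] A →ₗ[k] A :=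
  (TensorProduct.lid k A).toLinearMap ∘ₗ LinearMap.rTensor A H.counit ∘ₗ H.T₁.symm.toLinearMap

/-- The antipode identity `S(a₁)a₂ b = ε(a) b`. Formally `T₁⁻¹(p ⊗ q) = p₁ ⊗ S(p₂)q`, so applying
`ε` to the first leg of `T₁⁻¹` yields `S(p)q`. -/
theorem antipodeMul_T₁ (a b : A) : H.antipodeMul (H.T₁ (a ⊗ₜ b)) = H.counit a • b := by
  simp [antipodeMul]

/-- `T₁`, hence its inverse, is right `A`-linear in the second leg. This is what makes `q ↦ S(p)q`
the action of a multiplier when `A` is commutative. -/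
theorem antipodeMul_mul (p q a : A) :
    H.antipodeMul (p ⊗ₜ (q * a)) = H.antipodeMul (p ⊗ₜ q) * a := by
  obtain ⟨w, hw⟩ := H.T₁.surjective (p ⊗ₜ q)
  have h : p ⊗ₜ[k] (q * a) = H.T₁ (LinearMap.lTensor A (LinearMap.mulRight k a) w) := by
    rw [H.T₁_mulRight, hw]
    simp
  rw [h, ← hw]
  clear h hw
  induction w with
  | zero => simp
  | add x y hx hy => simp only [map_add, add_mul, hx, hy]
  | tmul x y => simp [antipodeMul_T₁, smul_mul_assoc]

/-- For commutative `A`, the multiplier `S(p)` of `A`. -/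
noncomputable def antipode (hcomm : ∀ a b : A, a * b = b * a) (p : A) : Multiplier k A :=
  Multiplier.mk' (H.antipodeMul ∘ₗ TensorProduct.mk k A A p)
    (H.antipodeMul ∘ₗ TensorProduct.mk k A A p) (by
      intro a b
      simp only [LinearMap.comp_apply, TensorProduct.mk_apply]
      rw [← H.antipodeMul_mul, hcomm a b, H.antipodeMul_mul, hcomm])

/-- `p ⊗ q ⊗ v ↦ S(p) q ⊗ v`. -/
noncomputable def antipodeMulTensorId (Y : Type*) [AddCommGroup Y] [Module k Y] :
    A ⊗[k] (A ⊗[k] Y) →ₗ[k] A ⊗[k] Y :=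
  LinearMap.rTensor Y H.antipodeMul ∘ₗ (TensorProduct.assoc k A A Y).symm.toLinearMap

theorem antipodeMulTensorId_tmul (hcomm : ∀ a b : A, a * b = b * a) (p : A) (x : A ⊗[k] Y) :
    H.antipodeMulTensorId Y (p ⊗ₜ x) =
      ((H.antipode hcomm p).tmul (1 : Multiplier k Y)).left x := by
  induction x with
  | zero => simp
  | add x y hx hy => simp only [TensorProduct.tmul_add, map_add, hx, hy]
  | tmul q v => simp [antipodeMulTensorId]; rfl

/-- On `p ⊗ x` the contraction is the action of `S(p) ⊗ 1`, which is central and so commutes with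
`n`. -/
theorem antipodeMulTensorId_left (hY : Nondegenerate Y) (hcomm : ∀ a b : A, a * b = b * a)
    (n : Multiplier k (A ⊗[k] Y)) (z : A ⊗[k] (A ⊗[k] Y)) :
    H.antipodeMulTensorId Y (LinearMap.lTensor A n.left z) =
      n.left (H.antipodeMulTensorId Y z) := by
  induction z with
  | zero => simp
  | add x y hx hy => simp only [map_add, hx, hy]
  | tmul p x =>
    rw [LinearMap.lTensor_tmul, H.antipodeMulTensorId_tmul hcomm, H.antipodeMulTensorId_tmul hcomm]
    exact congrArg (fun m => Multiplier.left m x)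
      (Multiplier.tmul_one_comm H.nondegenerate hY hcomm (H.antipode hcomm p) n)

theorem antipodeMulTensorId_right (hY : Nondegenerate Y) (hcomm : ∀ a b : A, a * b = b * a)
    (n : Multiplier k (A ⊗[k] Y)) (z : A ⊗[k] (A ⊗[k] Y)) :
    H.antipodeMulTensorId Y (LinearMap.lTensor A n.right z) =
      n.right (H.antipodeMulTensorId Y z) := by
  induction z with
  | zero => simp
  | add x y hx hy => simp only [map_add, hx, hy]
  | tmul p x =>
    rw [LinearMap.lTensor_tmul, H.antipodeMulTensorId_tmul hcomm, H.antipodeMulTensorId_tmul hcomm,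
      (H.nondegenerate.tensor hY).right_left_comm]

/-- For `x = c ⊗ v` the covered element is `c₁ ⊗ c₂d ⊗ v`, and `S(c₁)c₂d = ε(c)d`. -/
theorem antipodeMulTensorId_rightCover (d : A) (x : A ⊗[k] Y) :
    H.antipodeMulTensorId Y (H.rightCover Y (d ⊗ₜ x)) =
      d ⊗ₜ TensorProduct.lid k Y (LinearMap.rTensor Y H.counit x) := by
  induction x with
  | zero => simp
  | add x y hx hy => simp only [TensorProduct.tmul_add, map_add, hx, hy]
  | tmul c v =>
    simp [antipodeMulTensorId, rightCover, onFirstLegs, antipodeMul_T₁, TensorProduct.smul_tmul]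

/-- Both sides are `(a ⊗ 1)Δ(c)(1 ⊗ d)` on the first two legs; commutativity lets `d` act on the
second leg from either side. -/
theorem mulLeft_rightCover (hcomm : ∀ a b : A, a * b = b * a) (a d : A) (x : A ⊗[k] Y) :
    ((incl k A a).tmul (1 : Multiplier k (A ⊗[k] Y))).left (H.rightCover Y (d ⊗ₜ x)) =
      ((1 : Multiplier k A).tmul ((incl k A d).tmul (1 : Multiplier k Y))).left
        (H.leftCover Y (a ⊗ₜ x)) := by
  induction x with
  | zero => simp
  | add x y hx hy => simp only [TensorProduct.tmul_add, map_add, hx, hy]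
  | tmul c v =>
    have h1 : ∀ w : A ⊗[k] A, ((incl k A a).tmul (1 : Multiplier k (A ⊗[k] Y))).left
        (TensorProduct.assoc k A A Y (w ⊗ₜ v)) =
        TensorProduct.assoc k A A Y (LinearMap.rTensor A (LinearMap.mulLeft k a) w ⊗ₜ v) := by
      intro w
      induction w with
      | zero => simp
      | add x y hx hy => simp only [TensorProduct.add_tmul, map_add, hx, hy]
      | tmul p q => rfl
    have h2 : ∀ w : A ⊗[k] A,
        ((1 : Multiplier k A).tmul ((incl k A d).tmul (1 : Multiplier k Y))).left
        (TensorProduct.assoc k A A Y (w ⊗ₜ v)) =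
        TensorProduct.assoc k A A Y (LinearMap.lTensor A (LinearMap.mulRight k d) w ⊗ₜ v) := by
      intro w
      induction w with
      | zero => simp
      | add x y hx hy => simp only [TensorProduct.add_tmul, map_add, hx, hy]
      | tmul p q => exact congrArg (fun u => p ⊗ₜ[k] (u ⊗ₜ[k] v)) (hcomm d q)
    have h3 : H.rightCover Y (d ⊗ₜ (c ⊗ₜ v)) =
        TensorProduct.assoc k A A Y (H.T₁ (c ⊗ₜ d) ⊗ₜ v) := by
      simp [rightCover, onFirstLegs]
    have h4 : H.leftCover Y (a ⊗ₜ (c ⊗ₜ v)) =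
        TensorProduct.assoc k A A Y (H.T₂ (a ⊗ₜ c) ⊗ₜ v) := by
      simp [leftCover, onFirstLegs]
    rw [h3, h4, h1, h2, H.mulRight_T₂]

theorem eq_of_mulLeft_eq (hA : Nondegenerate A) (hY : Nondegenerate Y)
    {z z' : A ⊗[k] (A ⊗[k] Y)}
    (h : ∀ a : A, ((incl k A a).tmul (1 : Multiplier k (A ⊗[k] Y))).left z =
      ((incl k A a).tmul (1 : Multiplier k (A ⊗[k] Y))).left z') : z = z' := by
  rw [← sub_eq_zero]
  apply (hA.tensor (k := k) (hA.tensor (k := k) hY)).2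
  intro w
  rw [mul_sub, sub_eq_zero]
  induction w with
  | zero => simp
  | add x y hx hy => simp only [add_mul, hx, hy]
  | tmul a x =>
    have h1 : ∀ w : A ⊗[k] (A ⊗[k] Y), (a ⊗ₜ x) * w =
        LinearMap.lTensor A (LinearMap.mulLeft k x)
          (((incl k A a).tmul (1 : Multiplier k (A ⊗[k] Y))).left w) := by
      intro w
      induction w with
      | zero => simp
      | add x y hx hy => simp only [mul_add, map_add, hx, hy]
      | tmul p q => exact Algebra.TensorProduct.tmul_mul_tmul a p x q
    rw [h1, h1, h]

/-- For commutative `A`, the right action of `(Δ ⊗ ι)(m)` on `(Δ ⊗ ι)(x)(1 ⊗ d ⊗ 1)`. -/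
theorem comulTensorId_right_rightCover (hY : Nondegenerate Y)
    (hcomm : ∀ a b : A, a * b = b * a) (m : Multiplier k (A ⊗[k] Y)) (d : A) (x : A ⊗[k] Y) :
    (H.comulTensorId m).right (H.rightCover Y (d ⊗ₜ x)) = H.rightCover Y (d ⊗ₜ m.right x) := by
  have hA := H.nondegenerate
  have hAAY := hA.tensor (k := k) (hA.tensor (k := k) hY)
  -- The right action is defined through `leftCover`. Multiplying a right-covered element by `a ⊗ 1
  -- ⊗ 1` gives a left-covered one acted on by `1 ⊗ d ⊗ 1`; both of these left actions commute with
  -- the right action, and `a` is cancelled at the end.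
  have h : ∀ a, (H.comulTensorId m).right (H.leftCover Y (a ⊗ₜ x)) =
      H.leftCover Y (a ⊗ₜ m.right x) := by
    intro a
    change H.leftCover Y (LinearMap.lTensor A m.right
      ((H.leftCover Y).symm (H.leftCover Y (a ⊗ₜ x)))) = _
    rw [LinearEquiv.symm_apply_apply, LinearMap.lTensor_tmul]
  refine eq_of_mulLeft_eq hA hY fun a => ?_
  rw [← hAAY.right_left_comm, H.mulLeft_rightCover hcomm, hAAY.right_left_comm, h,
    H.mulLeft_rightCover hcomm]

theorem comulTensorId_left_rightCover (m : Multiplier k (A ⊗[k] Y)) (d : A) (x : A ⊗[k] Y) :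
    (H.comulTensorId m).left (H.rightCover Y (d ⊗ₜ x)) = H.rightCover Y (d ⊗ₜ m.left x) := by
  change H.rightCover Y (LinearMap.lTensor A m.left
    ((H.rightCover Y).symm (H.rightCover Y (d ⊗ₜ x)))) = _
  rw [LinearEquiv.symm_apply_apply, LinearMap.lTensor_tmul]

end MultiplierHopfAlgebra

/-! ### The spaces `ρ(Y)(A ⊗ Y)` and `(A ⊗ Y)ρ(Y)`, and multiplicativity of `T` -/

namespace CoveredMap

variable (C : CoveredMap k A Y)

/-- `y ⊗ x ↦ ρ(y) x`. -/
noncomputable def rhoLeft : Y ⊗[k] (A ⊗[k] Y) →ₗ[k] A ⊗[k] Y :=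
  TensorProduct.lift (Multiplier.leftHom ∘ₗ C.ρ)

/-- `y ⊗ x ↦ x ρ(y)`. -/
noncomputable def rhoRight : Y ⊗[k] (A ⊗[k] Y) →ₗ[k] A ⊗[k] Y :=
  TensorProduct.lift (Multiplier.rightHom ∘ₗ C.ρ)

theorem rhoLeft_tmul (y : Y) (x : A ⊗[k] Y) : C.rhoLeft (y ⊗ₜ x) = (C.ρ y).left x := rfl

theorem rhoRight_tmul (y : Y) (x : A ⊗[k] Y) : C.rhoRight (y ⊗ₜ x) = (C.ρ y).right x := rfl

/-- `S(p) ⊗ 1` passes `ρ(y)`, so contracting `p ⊗ ρ(y)x` gives `ρ(y)` times the contraction of `p ⊗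
x`. -/
theorem antipodeMulTensorId_rhoLeft (H : MultiplierHopfAlgebra k A) (hY : Nondegenerate Y)
    (hcomm : ∀ a b : A, a * b = b * a) (w : A ⊗[k] (Y ⊗[k] (A ⊗[k] Y))) :
    H.antipodeMulTensorId Y (LinearMap.lTensor A C.rhoLeft w) ∈ LinearMap.range C.rhoLeft := by
  induction w with
  | zero => simp
  | add x y hx hy => simpa only [map_add] using add_mem hx hy
  | tmul p u =>
    induction u with
    | zero => simp
    | add x y hx hy => simpa only [TensorProduct.tmul_add, map_add] using add_mem hx hy
    | tmul y x =>
      refine ⟨y ⊗ₜ H.antipodeMulTensorId Y (p ⊗ₜ x), ?_⟩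
      rw [rhoLeft_tmul, ← H.antipodeMulTensorId_left hY hcomm]
      rfl

theorem antipodeMulTensorId_rhoRight (H : MultiplierHopfAlgebra k A) (hY : Nondegenerate Y)
    (hcomm : ∀ a b : A, a * b = b * a) (w : A ⊗[k] (Y ⊗[k] (A ⊗[k] Y))) :
    H.antipodeMulTensorId Y (LinearMap.lTensor A C.rhoRight w) ∈ LinearMap.range C.rhoRight := by
  induction w with
  | zero => simp
  | add x y hx hy => simpa only [map_add] using add_mem hx hy
  | tmul p u =>
    induction u with
    | zero => simp
    | add x y hx hy => simpa only [TensorProduct.tmul_add, map_add] using add_mem hx hy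
    | tmul y x =>
      refine ⟨y ⊗ₜ H.antipodeMulTensorId Y (p ⊗ₜ x), ?_⟩
      rw [rhoRight_tmul, ← H.antipodeMulTensorId_right hY hcomm]
      rfl

theorem T_eq_Tbar (hA : Nondegenerate A) (hY : Nondegenerate Y)
    (hcomm : ∀ a b : A, a * b = b * a) (y : Y) (a : A) : C.T (y ⊗ₜ a) = C.Tbar (a ⊗ₜ y) := by
  apply incl_tensor_injective (k := k) hA hY
  rw [C.T_spec, C.Tbar_spec, Multiplier.tmul_one_comm hA hY hcomm]

theorem T_tmul_mul (y : Y) (a b : A) (v : Y) :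
    C.T (y ⊗ₜ a) * (b ⊗ₜ v) = (C.ρ y).left ((a * b) ⊗ₜ v) :=
  congrArg (fun m => Multiplier.left m (b ⊗ₜ v)) (C.T_spec y a)

theorem tmul_mul_Tbar (y : Y) (a b : A) (v : Y) :
    (b ⊗ₜ v) * C.Tbar (a ⊗ₜ y) = (C.ρ y).right ((b * a) ⊗ₜ v) :=
  congrArg (fun m => Multiplier.right m (b ⊗ₜ v)) (C.Tbar_spec a y)

/-- Since `A² = A`, it suffices that `ρ(y)(ab ⊗ v) = T(y ⊗ a)(b ⊗ v)`. -/
theorem range_rhoLeft_le (H : MultiplierHopfAlgebra k A) :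
    LinearMap.range C.rhoLeft ≤ LinearMap.range (leftAct C.T) := by
  rintro _ ⟨w, rfl⟩
  induction w with
  | zero => simp
  | add x y hx hy => simpa only [map_add] using add_mem hx hy
  | tmul y x =>
    induction x with
    | zero => simp
    | add x y hx hy => simpa only [TensorProduct.tmul_add, map_add] using add_mem hx hy
    | tmul c v =>
      obtain ⟨w, rfl⟩ := H.mul_surjective c
      induction w with
      | zero => simp
      | add x y hx hy =>
        simpa only [TensorProduct.add_tmul, TensorProduct.tmul_add, map_add] using add_mem hx hy
      | tmul a b => exact ⟨(y ⊗ₜ a) ⊗ₜ (b ⊗ₜ v), C.T_tmul_mul y a b v⟩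

theorem range_rhoRight_le (H : MultiplierHopfAlgebra k A) (hY : Nondegenerate Y)
    (hcomm : ∀ a b : A, a * b = b * a) :
    LinearMap.range C.rhoRight ≤ LinearMap.range (rightAct C.T) := by
  rintro _ ⟨w, rfl⟩
  induction w with
  | zero => simp
  | add x y hx hy => simpa only [map_add] using add_mem hx hy
  | tmul y x =>
    induction x with
    | zero => simp
    | add x y hx hy => simpa only [TensorProduct.tmul_add, map_add] using add_mem hx hy
    | tmul c v =>
      obtain ⟨w, rfl⟩ := H.mul_surjective c
      induction w with
      | zero => simp
      | add x y hx hy =>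
        simpa only [TensorProduct.add_tmul, TensorProduct.tmul_add, map_add] using add_mem hx hy
      | tmul b a =>
        refine ⟨(y ⊗ₜ a) ⊗ₜ (b ⊗ₜ v), ?_⟩
        rw [rightAct_tmul, C.T_eq_Tbar H.nondegenerate hY hcomm]
        exact C.tmul_mul_Tbar y a b v

/-- Centrality of `a ⊗ 1` gives `ρ(y)ρ(y')(aa' ⊗ 1) = ρ(y)(a ⊗ 1)ρ(y')(a' ⊗ 1)`. -/
theorem T_mul (hA : Nondegenerate A) (hY : Nondegenerate Y)
    (hcomm : ∀ a b : A, a * b = b * a) (hρ : ∀ y y' : Y, C.ρ (y * y') = C.ρ y * C.ρ y')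
    (x x' : Y ⊗[k] A) : C.T (x * x') = C.T x * C.T x' := by
  induction x with
  | zero => simp
  | add x y hx hy => simp only [add_mul, map_add, hx, hy]
  | tmul y a =>
    induction x' with
    | zero => simp
    | add x y hx hy => simp only [mul_add, map_add, hx, hy]
    | tmul y' a' =>
      apply incl_tensor_injective (k := k) hA hY
      have h : (incl k A (a * a')).tmul (1 : Multiplier k Y) =
          (incl k A a).tmul (1 : Multiplier k Y) * (incl k A a').tmul (1 : Multiplier k Y) := by
        rw [map_mul, Multiplier.tmul_mul_tmul, mul_one]
      rw [Algebra.TensorProduct.tmul_mul_tmul, map_mul, C.T_spec, C.T_spec, C.T_spec, hρ, h,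
        mul_assoc, mul_assoc, ← mul_assoc (C.ρ y') (Multiplier.tmul _ _),
        ← Multiplier.tmul_one_comm hA hY hcomm _ (C.ρ y'), mul_assoc]

end CoveredMap

/-! ### `E` is the idempotent onto which `T` is nondegenerate -/

theorem RegularMultiplierHopfAlgebra.counitTensorId_surjective [Nontrivial A]
    (HA : RegularMultiplierHopfAlgebra k A) :
    Function.Surjective (CoveredMap.counitTensorId HA Y) := by
  intro y
  obtain ⟨a, ha⟩ := HA.counit_surjective 1
  exact ⟨a ⊗ₜ y, by simp [CoveredMap.counitTensorId, ha]⟩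

namespace SymmetricPartialComoduleBialgebra

variable {HA : RegularMultiplierHopfAlgebra k A} {HY : RegularMultiplierHopfAlgebra k Y}
variable (P : SymmetricPartialComoduleBialgebra HA HY)

/-- `E(A ⊗ Y) ⊆ ρ(Y)(A ⊗ Y)`. -/
theorem E_left_mem (hcomm : ∀ a b : A, a * b = b * a) (c : A ⊗[k] Y) :
    P.E.left c ∈ LinearMap.range P.rhoLeft := by
  rcases subsingleton_or_nontrivial A with hA | hA
  · rw [Subsingleton.elim c 0, map_zero]
    exact zero_mem _
  induction c with
  | zero => simp
  | add x y hx hy => simpa only [map_add] using add_mem hx hy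
  | tmul d v =>
    obtain ⟨w, rfl⟩ := HY.mul_surjective v
    induction w with
    | zero => simp
    | add x y hx hy => simpa only [TensorProduct.tmul_add, map_add] using add_mem hx hy
    | tmul y y' =>
      obtain ⟨x, rfl⟩ := HA.counitTensorId_surjective y'
      -- With `y' = (ε ⊗ ι)(x)`, the counit axiom makes `y y'` equal to `(ε ⊗ ι)(ρ(y)x)`, the form
      -- that the contraction of `(Δ ⊗ ι)(ρ(y)x)(1 ⊗ d ⊗ 1)` produces.
      rw [LinearMap.mul'_apply, ← P.comoduleCoalgebra.counit_left y x]
      have h := congrArg (fun m => HA.antipodeMulTensorId Y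
        (Multiplier.left m (HA.rightCover Y (d ⊗ₜ x)))) (P.comoduleAlgebra.coassoc y)
      simp only [Multiplier.mul_left, LinearMap.comp_apply,
        HA.comulTensorId_left_rightCover] at h
      have h' := h.trans (HA.antipodeMulTensorId_left HY.nondegenerate hcomm P.E _)
      rw [HA.antipodeMulTensorId_rightCover] at h'
      -- By definition `(ι ⊗ ρ)(ρ(y))` acts from the left with `lTensor A rhoLeft` as its last step,
      -- so its contraction lies in `ρ(Y)(A ⊗ Y)`.
      exact h' ▸ P.antipodeMulTensorId_rhoLeft HA.toMultiplierHopfAlgebra HY.nondegenerate hcomm _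

/-- `(A ⊗ Y)E ⊆ (A ⊗ Y)ρ(Y)`. -/
theorem E_right_mem (hcomm : ∀ a b : A, a * b = b * a) (c : A ⊗[k] Y) :
    P.E.right c ∈ LinearMap.range P.rhoRight := by
  rcases subsingleton_or_nontrivial A with hA | hA
  · rw [Subsingleton.elim c 0, map_zero]
    exact zero_mem _
  induction c with
  | zero => simp
  | add x y hx hy => simpa only [map_add] using add_mem hx hy
  | tmul d v =>
    obtain ⟨w, rfl⟩ := HY.mul_surjective v
    induction w with
    | zero => simp
    | add x y hx hy => simpa only [TensorProduct.tmul_add, map_add] using add_mem hx hy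
    | tmul y' y =>
      obtain ⟨x, rfl⟩ := HA.counitTensorId_surjective y'
      rw [LinearMap.mul'_apply, ← P.comoduleCoalgebra.counit_right y x]
      -- For right actions the factors of a product apply from left to right, so the form `(Δ ⊗
      -- ι)(ρ(y))(1 ⊗ E)` is the one that applies `E` last.
      have h := congrArg (fun m => HA.antipodeMulTensorId Y
        (Multiplier.right m (HA.rightCover Y (d ⊗ₜ x)))) (P.comoduleAlgebra.coassoc_symm y)
      simp only [Multiplier.mul_right, LinearMap.comp_apply,
        HA.comulTensorId_right_rightCover HY.nondegenerate hcomm] at h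
      have h' := h.trans (HA.antipodeMulTensorId_right HY.nondegenerate hcomm P.E _)
      rw [HA.antipodeMulTensorId_rightCover] at h'
      exact h' ▸ P.antipodeMulTensorId_rhoRight HA.toMultiplierHopfAlgebra HY.nondegenerate hcomm _

theorem E_left_T (x : Y ⊗[k] A) : P.E.left (P.T x) = P.T x := by
  induction x with
  | zero => simp
  | add x y hx hy => simp only [map_add, hx, hy]
  | tmul y a =>
    obtain ⟨x, hx⟩ := P.comoduleAlgebra.T_mem y a
    rw [hx]
    exact congrArg (fun m => Multiplier.left m x) P.comoduleAlgebra.idem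

/-- The axiom gives `(A ⊗ 1)ρ(Y) ⊆ (A ⊗ Y)E`, and for commutative `A` the left side is the image of
`T` as well. -/
theorem E_right_T (hcomm : ∀ a b : A, a * b = b * a) (x : Y ⊗[k] A) :
    P.E.right (P.T x) = P.T x := by
  induction x with
  | zero => simp
  | add x y hx hy => simp only [map_add, hx, hy]
  | tmul y a =>
    obtain ⟨x, hx⟩ := P.comoduleAlgebra.Tbar_mem a y
    rw [P.T_eq_Tbar HA.nondegenerate HY.nondegenerate hcomm, hx]
    exact congrArg (fun m => Multiplier.right m x) P.comoduleAlgebra.idem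

theorem isNondegenerateOnto (hcomm : ∀ a b : A, a * b = b * a) :
    IsNondegenerateOnto P.T P.E where
  map_mul := P.T_mul HA.nondegenerate HY.nondegenerate hcomm P.comoduleAlgebra.map_mul
  idem := P.comoduleAlgebra.idem
  left_map := P.E_left_T
  right_map := P.E_right_T hcomm
  left_mem c := P.range_rhoLeft_le HA.toMultiplierHopfAlgebra (P.E_left_mem hcomm c)
  right_mem c := P.range_rhoRight_le HA.toMultiplierHopfAlgebra HY.nondegenerate hcomm
    (P.E_right_mem hcomm c)

end SymmetricPartialComoduleBialgebra

end Commutative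

end MultHopf

theorem mainTheorem11 {k : Type*} [Field k]
    {A : Type*} [NonUnitalRing A] [Module k A] [IsScalarTower k A A] [SMulCommClass k A A]
    {Y : Type*} [NonUnitalRing Y] [Module k Y] [IsScalarTower k Y Y] [SMulCommClass k Y Y]
    (HA : MultHopf.RegularMultiplierHopfAlgebra k A)
    (HY : MultHopf.RegularMultiplierHopfAlgebra k Y)
    (hcomm : ∀ a b : A, a * b = b * a)
    (P : MultHopf.SymmetricPartialComoduleBialgebra HA HY) :
    ∃ Ttilde : MultHopf.Multiplier k (Y ⊗[k] A) →ₙₐ[k] MultHopf.Multiplier k (A ⊗[k] Y),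
      (∀ x : Y ⊗[k] A, Ttilde (MultHopf.incl k (Y ⊗[k] A) x) =
        MultHopf.incl k (A ⊗[k] Y) (P.T x)) ∧
      Ttilde 1 = P.E ∧
      ∀ S : MultHopf.Multiplier k (Y ⊗[k] A) →ₙₐ[k] MultHopf.Multiplier k (A ⊗[k] Y),
        (∀ x : Y ⊗[k] A, S (MultHopf.incl k (Y ⊗[k] A) x) =
          MultHopf.incl k (A ⊗[k] Y) (P.T x)) →
        S 1 = P.E → S = Ttilde :=
  (P.isNondegenerateOnto hcomm).exists_unique_extension
    (HY.nondegenerate.tensor HA.nondegenerate) (HA.nondegenerate.tensor HY.nondegenerate)
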